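/- Let $\mathcal E$ be a complex Hilbert space, $\mathcal L(\mathcal E)$ the bounded operators on $\mathcal E$, and $N\ge 1$. Let $$\mathcal B_N(\mathcal E)=\Big\{Z=[Z_1\ \cdots\ Z_N]\in\mathcal L(\mathcal E)^N : \sum_{k=1}^N Z_k^*Z_k<I\Big\},$$ where $A<I$ means that $I-A$ is positive and boundedly invertible. Put $\mathcal E_0=\mathcal E$ and $\mathcal E_k=\mathcal E_{k-1}\oplus\cdots\oplus\mathcal E_{k-1}$ ($N$ summands) for $k\ge1$; thus $\mathcal E_k$ is the direct sum of copies of $\mathcal E$ indexed by the words $\sigma=i_1\cdots i_k$ of length $|\sigma|=k$ in the letters $1,\dots,N$, the first letter giving the summand $\mathcal E_{k-1}$. For such $\sigma$ let $Z^*_\sigma=Z^*_{i_1}\cdots Z^*_{i_k}$ (with $Z^*_\emptyset=I$). For $Z\in\mathcal B_N(\mathcal E)$ let $L(Z)=[Z^*_\sigma]_{|\sigma|\ge0}$ be the bounded row operator $\bigoplus_{k\ge0}\mathcal E_k\to\mathcal E$, $(x_\sigma)_\sigma\mapsto\sum_\sigma Z^*_\sigma x_\sigma$. Let $\mathcal S(\mathcal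 H,\mathcal E)$, with $\mathcal H=\mathbb C^N$, be the set of all contractions $T=[T_{ij}]_{i,j\ge0}$ on the Hilbert direct sum $\bigoplus_{k\ge0}\mathcal E_k$ that are upper triangular ($T_{ij}=0$ for $i>j$) and satisfy $T_{ij}=T_{i-1,j-1}\oplus\cdots\oplus T_{i-1,j-1}$ ($N$ summands) for $1\le i\le j$. Let $T(Z)=P_{\mathcal E}\,T\,L(Z)^*\in\mathcal L(\mathcal E)$, where $P_{\mathcal E}$ is the orthogonal projection of $\bigoplus_{k\ge0}\mathcal E_k$ onto $\mathcal E=\mathcal E_0$, and for $X\in\mathcal L(\mathcal E)$ let $\mathrm{diag}[X]$ be the operator $(x_\sigma)_\sigma\mapsto(Xx_\sigma)_\sigma$ on $\bigoplus_{k\ge0}\mathcal E_k$. **Theorem.** Let $Z_1,\dots,Z_n$ be distinct elements of $\mathcal B_N(\mathcal E)$ and let $B_1,\dots,B_n\in\mathcal L(\mathcal E)$. There is $T\in\mathcal S(\mathcal H,\mathcal E)$ with $T(Z_k)=B_k$ for $k=1,\dots,n$ if and only if the Pick matrix $$P=\Big[L(Z_j)\,\mathrm{diag}[I-B_j^*B_k]\,L(Z_k)^*\Big]_{j,k=1}^n,$$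 regarded as a bounded operator on $\mathcal E^n$, is positive (positive semidefinite). -/

import Mathlib

namespace NCInterp

noncomputable section

open scoped BigOperators

variable (N : ℕ) (E : Type*) [NormedAddCommGroup E] [InnerProductSpace ℂ E]

/-- The words in `N` letters: the elements of the unital free semigroup with `N` generators. The
empty word is `[]`, the length of `σ` is `σ.length`. -/
abbrev Word (N : ℕ) : Type := List (Fin N)

/-- The Hilbert space `⊕_{k ≥ 0} E_k`, where `E_0 = E` and `E_k` is the direct sum of `N` copies of
`E_{k-1}`. Unfolding the recursion, `E_k` is the direct sum of copies of `E` indexed by the words of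
length `k`, the first letter of the word telling the copy of `E_{k-1}`; so the whole space is the
Hilbert direct sum of copies of `E` indexed by all words. -/
abbrev Fock : Type _ := lp (fun _ : Word N => E) 2

variable {N E}

/-- The component `x_σ ∈ E` of `x`; for `σ = []` this is the orthogonal projection
`P_E` onto `E = E_0`. -/
def coord (σ : Word N) : Fock N E →L[ℂ] E :=
  lp.evalCLM ℂ (fun _ : Word N => E) 2 σ

/-- The inclusion of the copy of `E` with index `σ`. -/
def incl (σ : Word N) : E →L[ℂ] Fock N E :=
  lp.singleContinuousLinearMap ℂ (fun _ : Word N => E) 2 σ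

/-- The entry of index `(σ, τ)` of `T`. The block `T_{ij} : E_j → E_i` of `T` is the matrix of the
`entry T σ τ` with `σ` of length `i` and `τ` of length `j`. -/
def entry (T : Fock N E →L[ℂ] Fock N E) (σ τ : Word N) : E →L[ℂ] E :=
  (coord σ).comp (T.comp (incl τ))

variable (N E)

/-- The bounded operators `T = [T_{ij}]` on `⊕ E_k` that are upper triangular (`T_{ij} = 0` for
`i > j`) and satisfy `T_{ij} = T_{i-1,j-1} ⊕ ⋯ ⊕ T_{i-1,j-1}` (`N` summands) for `1 ≤ i ≤ j`. Here
`E_i` and `E_j` are split into `N` copies of `E_{i-1}` and `E_{j-1}` by the first letter, so the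
right hand side has entry `T_{σ,τ}` at `(kσ, kτ)`, and `0` at `(kσ, lτ)` for `k ≠ l`. -/
def toeplitzAlg : Set (Fock N E →L[ℂ] Fock N E) :=
  {T | (∀ σ τ : Word N, τ.length < σ.length → entry T σ τ = 0) ∧
    ∀ (k l : Fin N) (σ τ : Word N), σ.length ≤ τ.length →
      entry T (k :: σ) (l :: τ) = if k = l then entry T σ τ else 0}

/-- The Schur class: the contractions in the above algebra. -/
def schurClass : Set (Fock N E →L[ℂ] Fock N E) :=
  {T | T ∈ toeplitzAlg N E ∧ ‖T‖ ≤ 1}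

variable {N E}

lemma memlp_map (X : E →L[ℂ] E) (x : Fock N E) : Memℓp (fun σ => X (x σ)) 2 := by
  have hx : Memℓp (fun σ => ‖X‖ • x σ) 2 := (lp.memℓp x).const_smul ‖X‖
  have h2 : (0 : ℝ) < (2 : ENNReal).toReal := by norm_num
  refine memℓp_gen (((memℓp_gen_iff h2).1 hx).of_nonneg_of_le (fun σ => by positivity) fun σ => ?_)
  gcongr
  simpa [norm_smul] using X.le_opNorm (x σ)

/-- `diag[X]`, the direct sum of copies of `X`: it maps `(x_σ)` to `(X x_σ)`. -/
def diag (X : E →L[ℂ] E) : Fock N E →L[ℂ] Fock N E :=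
  LinearMap.mkContinuous
    { toFun := fun x => ⟨fun σ => X (x σ), memlp_map X x⟩
      map_add' := fun x y => lp.ext (funext fun σ => X.map_add (x σ) (y σ))
      map_smul' := fun c x => lp.ext (funext fun σ => X.map_smul c (x σ)) }
    ‖X‖ (fun x => by
      have h2 : (0 : ℝ) < (2 : ENNReal).toReal := by norm_num
      refine lp.norm_le_of_forall_sum_le h2 (by positivity) fun s => ?_
      calc ∑ σ ∈ s, ‖X (x σ)‖ ^ (2 : ENNReal).toReal
          ≤ ∑ σ ∈ s, (‖X‖ * ‖x σ‖) ^ (2 : ENNReal).toReal := by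
            gcongr with σ _
            exact X.le_opNorm _
        _ = ‖X‖ ^ (2 : ENNReal).toReal * ∑ σ ∈ s, ‖x σ‖ ^ (2 : ENNReal).toReal := by
            rw [Finset.mul_sum]
            exact Finset.sum_congr rfl fun σ _ => Real.mul_rpow (norm_nonneg _) (norm_nonneg _)
        _ ≤ (‖X‖ * ‖x‖) ^ (2 : ENNReal).toReal := by
            rw [Real.mul_rpow (norm_nonneg _) (norm_nonneg _)]
            gcongr
            exact lp.sum_rpow_le_norm_rpow h2 x s)

@[simp] lemma diag_apply (X : E →L[ℂ] E) (x : Fock N E) (σ : Word N) :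
    (diag X x) σ = X (x σ) := rfl

/-- The bounded operator on `E^n = E ⊕ ⋯ ⊕ E` given by an `n × n` matrix of operators on `E`. -/
def blockOperator {n : ℕ} (M : Fin n → Fin n → E →L[ℂ] E) :
    PiLp 2 (fun _ : Fin n => E) →L[ℂ] PiLp 2 (fun _ : Fin n => E) :=
  (PiLp.continuousLinearEquiv 2 ℂ (fun _ : Fin n => E)).symm.toContinuousLinearMap.comp
    (ContinuousLinearMap.pi fun j => ∑ k, (M j k).comp (PiLp.proj 2 (fun _ : Fin n => E) k))

@[simp] lemma blockOperator_apply {n : ℕ} (M : Fin n → Fin n → E →L[ℂ] E)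
    (x : PiLp 2 (fun _ : Fin n => E)) (j : Fin n) :
    (blockOperator M x) j = ∑ k, M j k (x k) := by
  simp [blockOperator]

variable [CompleteSpace E]

/-- The form `(Z | W) = ∑ k, Z_k^* W_k` on `N`-tuples of bounded operators on `E`. -/
def form (Z W : Fin N → E →L[ℂ] E) : E →L[ℂ] E :=
  ∑ k, star (Z k) * W k

variable (N E) in
/-- The open operator ball: the `N`-tuples `Z` of bounded operators on `E` with `(Z | Z) < I`. As
usual for operators, `A < I` means that `I - A` is strictly positive, i.e. positive and boundedly
invertible (equivalently here, `‖(Z | Z)‖ < 1`). -/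
def opBall : Set (Fin N → E →L[ℂ] E) :=
  {Z | IsStrictlyPositive (1 - form Z Z)}

/-- `Z^*_σ = Z^*_{i₁} ⋯ Z^*_{iₖ}` for the word `σ = i₁ ⋯ iₖ`, and `I` for the empty word. -/
def starWord (Z : Fin N → E →L[ℂ] E) (σ : Word N) : E →L[ℂ] E :=
  (σ.map fun i => star (Z i)).prod

lemma star_starWord_cons (Z : Fin N → E →L[ℂ] E) (i : Fin N) (σ : Word N) (e : E) :
    star (starWord Z (i :: σ)) e = star (starWord Z σ) (Z i e) := by
  simp [starWord]

lemma exists_bound {Z : Fin N → E →L[ℂ] E} (hZ : Z ∈ opBall N E) :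
    ∃ r : ℝ, 0 < r ∧ ∀ e : E, r * ‖e‖ ^ 2 + ∑ i, ‖Z i e‖ ^ 2 ≤ ‖e‖ ^ 2 := by
  cases subsingleton_or_nontrivial E with
  | inl hE =>
    refine ⟨1, one_pos, fun e => ?_⟩
    have h0 : ∀ x : E, ‖x‖ = 0 := fun x => by rw [Subsingleton.elim x 0, norm_zero]
    simp [h0]
  | inr hE =>
    have h : IsStrictlyPositive (1 - form Z Z) := hZ
    have hsa : IsSelfAdjoint (1 - form Z Z) := h.nonneg.isSelfAdjoint
    obtain ⟨r, hr, hle⟩ := (CFC.exists_pos_algebraMap_le_iff hsa).2 (fun x hx => h.spectrum_pos hx)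
    refine ⟨r, hr, fun e => ?_⟩
    have h3 := ((ContinuousLinearMap.le_def _ _).1 hle).re_inner_nonneg_left e
    have h4 : ∀ i, inner ℂ ((star (Z i)) ((Z i) e)) e = ((‖Z i e‖ ^ 2 : ℝ) : ℂ) := fun i => by
      rw [ContinuousLinearMap.star_eq_adjoint, ContinuousLinearMap.adjoint_inner_left,
        inner_self_eq_norm_sq_to_K]
      simp
    have h5 : inner ℂ ((algebraMap ℝ (E →L[ℂ] E) r) e) e = ((r * ‖e‖ ^ 2 : ℝ) : ℂ) := by
      rw [Algebra.algebraMap_eq_smul_one]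
      change inner ℂ (r • e) e = _
      rw [← Complex.coe_smul, inner_smul_left, inner_self_eq_norm_sq_to_K]
      simp
    have h6 : inner ℂ e e = ((‖e‖ ^ 2 : ℝ) : ℂ) := by
      rw [inner_self_eq_norm_sq_to_K]
      simp
    simp only [form, sub_apply, sum_apply,
      mul_apply_eq_comp, one_apply_eq_self, inner_sub_left,
      sum_inner, h4, h5, h6] at h3
    rw [← Complex.ofReal_sum, ← Complex.ofReal_sub, ← Complex.ofReal_sub] at h3
    have h7 : ∀ t : ℝ, RCLike.re (t : ℂ) = t := fun t => Complex.ofReal_re t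
    rw [h7] at h3
    linarith

/-- The finite set of words of length less than `K`. -/
def wordsLT (N : ℕ) : ℕ → Finset (Word N)
  | 0 => ∅
  | K + 1 => insert [] ((Finset.univ ×ˢ wordsLT N K).image fun p => p.1 :: p.2)

lemma mem_wordsLT (K : ℕ) (σ : Word N) (h : σ.length < K) : σ ∈ wordsLT N K := by
  induction K generalizing σ with
  | zero => omega
  | succ K ih =>
    cases σ with
    | nil => simp [wordsLT]
    | cons i σ =>
      have := ih σ (by simpa using h)
      simp [wordsLT, this]

lemma sum_wordsLT (f : Word N → ℝ) (K : ℕ) :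
    ∑ σ ∈ wordsLT N (K + 1), f σ = f [] + ∑ i, ∑ σ ∈ wordsLT N K, f (i :: σ) := by
  rw [wordsLT, Finset.sum_insert (by simp), Finset.sum_image, Finset.sum_product]
  rintro ⟨a, b⟩ _ ⟨c, d⟩ _ h
  simpa using h

lemma exists_column_bound {Z : Fin N → E →L[ℂ] E} (hZ : Z ∈ opBall N E) :
    ∃ C : ℝ, 0 ≤ C ∧ ∀ (e : E) (s : Finset (Word N)),
      ∑ σ ∈ s, ‖star (starWord Z σ) e‖ ^ 2 ≤ C * ‖e‖ ^ 2 := by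
  obtain ⟨r, hr, hb⟩ := exists_bound hZ
  have key : ∀ (K : ℕ) (e : E),
      ∑ σ ∈ wordsLT N K, ‖star (starWord Z σ) e‖ ^ 2 ≤ r⁻¹ * ‖e‖ ^ 2 := by
    intro K
    induction K with
    | zero => intro e; simp only [wordsLT, Finset.sum_empty]; positivity
    | succ K ih =>
      intro e
      rw [sum_wordsLT]
      simp only [star_starWord_cons]
      have h1 : ∑ i, ∑ σ ∈ wordsLT N K, ‖star (starWord Z σ) (Z i e)‖ ^ 2
          ≤ r⁻¹ * ∑ i, ‖Z i e‖ ^ 2 := by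
        rw [Finset.mul_sum]
        exact Finset.sum_le_sum fun i _ => ih (Z i e)
      have h2 : r⁻¹ * (r * ‖e‖ ^ 2 + ∑ i, ‖Z i e‖ ^ 2) ≤ r⁻¹ * ‖e‖ ^ 2 := by
        have := hb e
        gcongr
      have h3 : r⁻¹ * (r * ‖e‖ ^ 2) = ‖e‖ ^ 2 := by field_simp
      have h4 : ‖star (starWord Z []) e‖ ^ 2 = ‖e‖ ^ 2 := by simp [starWord]
      rw [h4]
      linarith
  refine ⟨r⁻¹, by positivity, fun e s => (Finset.sum_le_sum_of_subset_of_nonneg ?_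
    fun _ _ _ => by positivity).trans (key (s.sup List.length + 1) e)⟩
  exact fun σ hσ => mem_wordsLT _ _ (Nat.lt_succ_of_le (Finset.le_sup (f := List.length) hσ))

lemma memlp_column {Z : Fin N → E →L[ℂ] E} (hZ : Z ∈ opBall N E) (e : E) :
    Memℓp (fun σ : Word N => star (starWord Z σ) e) 2 := by
  obtain ⟨C, -, hC⟩ := exists_column_bound hZ
  exact memℓp_gen' (C := C * ‖e‖ ^ 2) fun s => by simpa using hC e s

/-- The bounded column operator `E → ⊕ E_k` with entries `(Z^*_σ)^*`. -/
def column (Z : opBall N E) : E →L[ℂ] Fock N E :=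
  LinearMap.mkContinuousOfExistsBound
    { toFun := fun e => ⟨fun σ => star (starWord Z.1 σ) e, memlp_column Z.2 e⟩
      map_add' := fun x y => lp.ext (funext fun σ => (star (starWord Z.1 σ)).map_add x y)
      map_smul' := fun c x => lp.ext (funext fun σ => (star (starWord Z.1 σ)).map_smul c x) }
    (by
      obtain ⟨C, hC0, hC⟩ := exists_column_bound Z.2
      refine ⟨√C, fun e => lp.norm_le_of_forall_sum_le (by norm_num) (by positivity) fun s => ?_⟩
      have h : (√C * ‖e‖) ^ 2 = C * ‖e‖ ^ 2 := by rw [mul_pow, Real.sq_sqrt hC0]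
      simpa [h] using hC e s)

/-- The bounded row operator `L(Z) = [Z^*_σ]_{|σ| ≥ 0} : ⊕ E_k → E`, `(x_σ) ↦ ∑_σ Z^*_σ x_σ`. -/
def L (Z : opBall N E) : Fock N E →L[ℂ] E :=
  ContinuousLinearMap.adjoint (column Z)

/-- The entry of index `σ` of the row `L(Z)` is `Z^*_σ`. -/
lemma L_incl (Z : opBall N E) (σ : Word N) (e : E) : L Z (incl σ e) = starWord Z.1 σ e := by
  refine ext_inner_right ℂ fun v => ?_
  rw [L, ContinuousLinearMap.adjoint_inner_left]
  change inner ℂ (lp.single 2 σ e) (column Z v) = _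
  rw [lp.inner_single_left]
  change inner ℂ e (star (starWord Z.1 σ) v) = _
  rw [ContinuousLinearMap.star_eq_adjoint, ContinuousLinearMap.adjoint_inner_right]

/-- The formula `L(Z) x = ∑_σ Z^*_σ x_σ`. -/
lemma hasSum_L (Z : opBall N E) (x : Fock N E) :
    HasSum (fun σ => starWord Z.1 σ (coord σ x)) (L Z x) := by
  have h := (lp.hasSum_single (E := fun _ : Word N => E) (p := 2) (by simp) x).mapL (L Z)
  simp only [← L_incl]
  exact h

/-- The point evaluation `T(Z) = P_E T L(Z)^*`. -/
def pointEval (T : Fock N E →L[ℂ] Fock N E) (Z : opBall N E) : E →L[ℂ] E :=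
  (coord []).comp (T.comp (ContinuousLinearMap.adjoint (L Z)))

/-- The Pick matrix `[L(Z_j) diag[I - B_j^* B_k] L(Z_k)^*]_{j,k}`, as an operator on `E^n`. -/
def pickMatrix {n : ℕ} (Z : Fin n → opBall N E) (B : Fin n → E →L[ℂ] E) :
    PiLp 2 (fun _ : Fin n => E) →L[ℂ] PiLp 2 (fun _ : Fin n => E) :=
  blockOperator fun j k =>
    (L (Z j)).comp ((diag (1 - star (B j) * B k)).comp (ContinuousLinearMap.adjoint (L (Z k))))

end

end NCInterp

namespace NCInterp

noncomputable section

variable {N : ℕ} {E : Type*} [NormedAddCommGroup E] [InnerProductSpace ℂ E]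
  {G : Type*} [NormedAddCommGroup G] [InnerProductSpace ℂ G]

/-! Write `S_i = shift [i]` and `C_Z = column Z = L(Z)^*`. Everything rests on two facts: the
Toeplitz algebra is the commutant of the shifts `S_i` (`mem_toeplitzAlg_iff`), and `S_i C_Z = C_Z
Z_i` (`shift_column`).

Necessity. Together these give `T C_Z = diag[T(Z)] C_Z` (`apply_column`). The Pick matrix is `C_1^*
C_1 - C_B^* C_B`, where `C_B` is the row of the operators `diag[B_k] C_{Z_k}` and `C_1` is the case
`B_k = I`. Interpolation therefore means `C_B = T C_1`, and contractivity of `T` makes the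
difference positive.

Sufficiency is a lurking isometry argument. With `P = D^2`, splitting off first letters gives the
Stein identity `‖D x‖² + ‖∑ B_k x_k‖² = ‖∑ x_k‖² + ∑_i ‖D Z_i x‖²` (`re_inner_pickMatrix`). So a
contraction `V` sends `(∑ x_k, (D Z_i x)_i)` to `(∑ B_k x_k, D x)`. Its transfer function `T` is in
the Schur class (`exists_realization`). On `C_{Z_k} e` the state of the system must be `D` applied
to `e` in slot `k`, because the recursion has only one solution over the open ball
(`eq_zero_of_norm_sq_le_sum`); the output is then `B_k e`. -/

lemma exists_subset_wordsLT (s : Finset (Word N)) : ∃ K, s ⊆ wordsLT N K :=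
  ⟨s.sup List.length + 1, fun _ hσ =>
    mem_wordsLT _ _ (Nat.lt_succ_of_le (Finset.le_sup (f := List.length) hσ))⟩

omit [InnerProductSpace ℂ E] in
lemma hasSum_norm_sq (x : Fock N E) : HasSum (fun σ => ‖x σ‖ ^ 2) (‖x‖ ^ 2) := by
  simpa using lp.hasSum_norm (p := 2) (by norm_num) x

omit [InnerProductSpace ℂ E] in
lemma sum_norm_sq_le (x : Fock N E) (s : Finset (Word N)) :
    ∑ σ ∈ s, ‖x σ‖ ^ 2 ≤ ‖x‖ ^ 2 :=
  sum_le_hasSum s (fun _ _ => by positivity) (hasSum_norm_sq x)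

lemma sum_column_le {g : Word N → G →L[ℂ] E}
    (hg : ∀ (K : ℕ) (d : G), ∑ σ ∈ wordsLT N K, ‖g σ d‖ ^ 2 ≤ ‖d‖ ^ 2) (d : G)
    (s : Finset (Word N)) : ∑ σ ∈ s, ‖g σ d‖ ^ 2 ≤ ‖d‖ ^ 2 := by
  obtain ⟨K, hK⟩ := exists_subset_wordsLT s
  exact (Finset.sum_le_sum_of_subset_of_nonneg hK fun _ _ _ => by positivity).trans (hg K d)

/-- The operator `G → ⊕ E_k` with components `g σ`, bounded by `1`. -/
def ofColumn (g : Word N → G →L[ℂ] E)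
    (hg : ∀ (K : ℕ) (d : G), ∑ σ ∈ wordsLT N K, ‖g σ d‖ ^ 2 ≤ ‖d‖ ^ 2) : G →L[ℂ] Fock N E :=
  LinearMap.mkContinuous
    { toFun := fun d => ⟨fun σ => g σ d, memℓp_gen' (C := ‖d‖ ^ 2) fun s => by
        simpa using sum_column_le hg d s⟩
      map_add' := fun x y => lp.ext (funext fun σ => (g σ).map_add x y)
      map_smul' := fun c x => lp.ext (funext fun σ => (g σ).map_smul c x) }
    1 (fun d => by
      rw [one_mul]
      exact lp.norm_le_of_forall_sum_le (by norm_num) (norm_nonneg _) fun s => by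
        simpa using sum_column_le hg d s)

@[simp] lemma ofColumn_apply (g : Word N → G →L[ℂ] E)
    (hg : ∀ (K : ℕ) (d : G), ∑ σ ∈ wordsLT N K, ‖g σ d‖ ^ 2 ≤ ‖d‖ ^ 2) (d : G) (σ : Word N) :
    ofColumn g hg d σ = g σ d := rfl

lemma norm_ofColumn_le (g : Word N → G →L[ℂ] E)
    (hg : ∀ (K : ℕ) (d : G), ∑ σ ∈ wordsLT N K, ‖g σ d‖ ^ 2 ≤ ‖d‖ ^ 2) : ‖ofColumn g hg‖ ≤ 1 :=
  ContinuousLinearMap.opNorm_le_bound _ zero_le_one fun d => by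
    rw [one_mul]
    exact lp.norm_le_of_forall_sum_le (by norm_num) (norm_nonneg _) fun s => by
      simpa using sum_column_le hg d s

/-! ### Backward shifts and Toeplitz operators -/

/-- The backward shift `(x_τ)_τ ↦ (x_{στ})_τ`. -/
def shift (σ : Word N) : Fock N E →L[ℂ] Fock N E :=
  ofColumn (fun τ => coord (σ ++ τ)) fun K x => by
    have h := sum_norm_sq_le x ((wordsLT N K).map ⟨(σ ++ ·), List.append_right_injective σ⟩)
    rw [Finset.sum_map] at h
    exact h

@[simp] lemma shift_apply (σ τ : Word N) (x : Fock N E) : shift σ x τ = x (σ ++ τ) := rfl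

@[simp] lemma coord_apply (σ : Word N) (x : Fock N E) : coord σ x = x σ := rfl

lemma incl_apply (σ τ : Word N) (e : E) : incl σ e τ = if τ = σ then e else 0 := by
  change lp.single (E := fun _ : Word N => E) 2 σ e τ = _
  rw [lp.single_apply, Pi.single_apply]

lemma shift_nil (x : Fock N E) : shift [] x = x := rfl

lemma shift_incl_nil (i : Fin N) (e : E) : shift [i] (incl [] e) = 0 := by
  refine lp.ext (funext fun τ => ?_)
  simp [incl_apply]

lemma shift_incl_cons (i j : Fin N) (τ : Word N) (e : E) :
    shift [i] (incl (j :: τ) e) = if i = j then incl τ e else 0 := by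
  refine lp.ext (funext fun ρ => ?_)
  by_cases h : i = j <;> simp [incl_apply, h]

/-- A word is either empty or a first letter followed by a word. -/
def wordEquiv (N : ℕ) : Unit ⊕ (Fin N × Word N) ≃ Word N where
  toFun := Sum.elim (fun _ => []) fun p => p.1 :: p.2
  invFun
    | [] => Sum.inl ()
    | i :: σ => Sum.inr (i, σ)
  left_inv := by rintro (_ | _) <;> rfl
  right_inv := by rintro (_ | _) <;> rfl

/-- Sorting the words by first letter splits off the empty word. This identity drives every energy
balance below. -/
lemma inner_eq_add_sum_shift (x y : Fock N E) :
    inner ℂ x y = inner ℂ (x []) (y []) + ∑ i, inner ℂ (shift [i] x) (shift [i] y) := by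
  have h := lp.hasSum_inner (𝕜 := ℂ) x y
  rw [← (wordEquiv N).hasSum_iff] at h
  have h1 := h.summable.comp_injective Sum.inr_injective
  have h2 : HasSum (fun p : Fin N × Word N => inner ℂ (x (p.1 :: p.2)) (y (p.1 :: p.2)))
      (∑ i, inner ℂ (shift [i] x) (shift [i] y)) := by
    have h3 := h1.hasSum.prod_fiberwise fun i =>
      lp.hasSum_inner (𝕜 := ℂ) (shift [i] x) (shift [i] y)
    rw [(hasSum_fintype _).unique h3]
    exact h1.hasSum
  refine h.unique ?_
  refine HasSum.sum (f := (fun σ => inner ℂ (x σ) (y σ)) ∘ wordEquiv N) ?_ h2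
  exact hasSum_unique (fun _ : Unit => inner ℂ (x []) (y []))

lemma norm_sq_eq_add_sum_shift (x : Fock N E) :
    ‖x‖ ^ 2 = ‖x []‖ ^ 2 + ∑ i, ‖shift [i] x‖ ^ 2 := by
  have h := congrArg RCLike.re (inner_eq_add_sum_shift x x)
  simpa only [map_add, map_sum, inner_self_eq_norm_sq] using h

lemma ext_incl {A B : Fock N E →L[ℂ] G} (h : ∀ τ e, A (incl τ e) = B (incl τ e)) : A = B := by
  ext x
  have hx := lp.hasSum_single (E := fun _ : Word N => E) (p := 2) (by simp) x
  exact (hx.mapL A).unique ((hx.mapL B).congr_fun fun τ => h τ (x τ))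

/-- The Toeplitz operators are the operators that commute with the backward shifts. -/
lemma mem_toeplitzAlg_iff (T : Fock N E →L[ℂ] Fock N E) :
    T ∈ toeplitzAlg N E ↔ ∀ (i : Fin N) (x : Fock N E), shift [i] (T x) = T (shift [i] x) := by
  constructor
  · rintro ⟨h0, h1⟩ i x
    refine lp.ext (funext fun σ => ?_)
    refine DFunLike.congr_fun (f := (coord σ).comp ((shift [i]).comp T))
      (g := (coord σ).comp (T.comp (shift [i]))) (ext_incl fun τ e => ?_) x
    change entry T (i :: σ) τ e = T (shift [i] (incl τ e)) σ
    cases τ with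
    | nil => simp [h0 (i :: σ) [] (by simp), shift_incl_nil]
    | cons j τ =>
      rw [shift_incl_cons]
      -- The Toeplitz condition is only given on and above the diagonal; below it both entries
      -- vanish by triangularity.
      rcases le_or_gt σ.length τ.length with h | h
      · rw [h1 i j σ τ h]
        split_ifs
        · rfl
        · simp
      · rw [h0 _ _ (by simpa using h)]
        split_ifs
        · exact (DFunLike.congr_fun (h0 σ τ h) e).symm
        · simp
  · intro h
    have hc : ∀ (i j : Fin N) (σ τ : Word N),
        entry T (i :: σ) (j :: τ) = if i = j then entry T σ τ else 0 := fun i j σ τ => by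
      ext e
      change shift [i] (T (incl (j :: τ) e)) σ = _
      rw [h, shift_incl_cons]
      split_ifs
      · rfl
      · simp
    refine ⟨fun σ => ?_, fun i j σ τ _ => hc i j σ τ⟩
    -- Triangularity follows from commutation: first letters are stripped until the column word is
    -- empty, and the shifts annihilate that copy of `E`.
    induction σ with
    | nil => simp
    | cons i σ ih =>
      intro τ hτ
      cases τ with
      | nil =>
        ext e
        change shift [i] (T (incl [] e)) σ = _
        rw [h, shift_incl_nil]
        simp
      | cons j τ => rw [hc, ih τ (by simpa using hτ), ite_self]

/-! ### Contractive colligations and their transfer functions -/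

/-- The norm inequality makes `a x ↦ b x` well defined and contractive on the range of `a`. It
extends by continuity to the closure and by zero to the orthogonal complement. -/
lemma exists_contraction_of_norm_le {X H K : Type*} [AddCommGroup X] [Module ℂ X]
    [NormedAddCommGroup H] [InnerProductSpace ℂ H] [CompleteSpace H]
    [NormedAddCommGroup K] [InnerProductSpace ℂ K] [CompleteSpace K]
    (a : X →ₗ[ℂ] H) (b : X →ₗ[ℂ] K) (h : ∀ x, ‖b x‖ ≤ ‖a x‖) :
    ∃ V : H →L[ℂ] K, ‖V‖ ≤ 1 ∧ ∀ x, V (a x) = b x := by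
  let M := (LinearMap.range a).topologicalClosure
  have hM : ∀ x, a x ∈ M := fun x => Submodule.le_topologicalClosure _ ⟨x, rfl⟩
  have : CompleteSpace M := (Submodule.isClosed_topologicalClosure _).completeSpace_coe
  let e : X →ₗ[ℂ] M := a.codRestrict M hM
  have hd : DenseRange e := by
    rw [DenseRange, Subtype.dense_iff]
    intro y hy
    have : ((↑) '' Set.range e : Set H) = LinearMap.range a := by
      ext z
      simp [e]
    exact (congrArg (y ∈ closure ·) this).mpr hy
  have hn : ∀ x, ‖b x‖ ≤ 1 * ‖e x‖ := fun x => by simpa [e] using h x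
  refine ⟨(b.extendOfNorm e).comp M.orthogonalProjectionOnto, ?_, fun x => ?_⟩
  · refine (ContinuousLinearMap.opNorm_comp_le _ _).trans
      (mul_le_one₀ (LinearMap.opNorm_extendOfNorm_le hd zero_le_one hn) (norm_nonneg _)
        M.orthogonalProjectionOnto_norm_le)
  · have : M.orthogonalProjectionOnto (a x) = e x :=
      Submodule.orthogonalProjectionOnto_mem_subspace_eq_self (⟨a x, hM x⟩ : M)
    rw [ContinuousLinearMap.comp_apply, this, LinearMap.extendOfNorm_eq hd ⟨1, hn⟩]

variable (N E G) in
/-- The Hilbert space `E ⊕ G ⊕ ⋯ ⊕ G`, with `N` copies of `G`. -/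
abbrev Colligation : Type _ := WithLp 2 (E × PiLp 2 (fun _ : Fin N => G))

/-- The column of an operator to `E` and `N` operators to `G`. -/
def colligationMap {X : Type*} [NormedAddCommGroup X] [InnerProductSpace ℂ X]
    (a : X →L[ℂ] E) (b : Fin N → X →L[ℂ] G) : X →L[ℂ] Colligation N E G :=
  (WithLp.prodContinuousLinearEquiv 2 ℂ E (PiLp 2 fun _ : Fin N => G)).symm.toContinuousLinearMap.comp
    (a.prod ((PiLp.continuousLinearEquiv 2 ℂ fun _ : Fin N => G).symm.toContinuousLinearMap.comp
      (ContinuousLinearMap.pi b)))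

section

variable {X : Type*} [NormedAddCommGroup X] [InnerProductSpace ℂ X]

@[simp] lemma colligationMap_fst (a : X →L[ℂ] E) (b : Fin N → X →L[ℂ] G) (x : X) :
    (colligationMap a b x).fst = a x := rfl

@[simp] lemma colligationMap_snd (a : X →L[ℂ] E) (b : Fin N → X →L[ℂ] G) (x : X) (i : Fin N) :
    (colligationMap a b x).snd i = b i x := rfl

end

omit [InnerProductSpace ℂ E] [InnerProductSpace ℂ G] in
lemma colligation_norm_sq (h : Colligation N E G) :
    ‖h‖ ^ 2 = ‖h.fst‖ ^ 2 + ∑ i, ‖h.snd i‖ ^ 2 := by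
  rw [WithLp.prod_norm_sq_eq_of_L2, PiLp.norm_sq_eq_of_L2]

lemma colligation_inner (h k : Colligation N E G) :
    inner ℂ h k = inner ℂ h.fst k.fst + ∑ i, inner ℂ (h.snd i) (k.snd i) := by
  rw [WithLp.prod_inner_apply, PiLp.inner_apply]
  rfl

omit [NormedAddCommGroup E] [InnerProductSpace ℂ E] [NormedAddCommGroup G]
  [InnerProductSpace ℂ G] in
lemma colligation_ext {h k : Colligation N E G} (h0 : h.fst = k.fst)
    (h1 : ∀ i, h.snd i = k.snd i) : h = k := by
  refine (WithLp.equiv 2 _).injective (Prod.ext h0 (PiLp.ext h1))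

/-- The components of the observability operator of an operator `W : G → E ⊕ G ⊕ ⋯ ⊕ G`. -/
def observe (W : G →L[ℂ] Colligation N E G) : Word N → G →L[ℂ] E
  | [] => (WithLp.fstL 2 ℂ E _).comp W
  | i :: σ => (observe W σ).comp
      ((PiLp.proj 2 (fun _ : Fin N => G) i).comp ((WithLp.sndL 2 ℂ E _).comp W))

lemma observe_nil (W : G →L[ℂ] Colligation N E G) (d : G) : observe W [] d = (W d).fst := rfl

lemma observe_cons (W : G →L[ℂ] Colligation N E G) (i : Fin N) (σ : Word N) (d : G) :
    observe W (i :: σ) d = observe W σ ((W d).snd i) := rfl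

lemma sum_observe_le {W : G →L[ℂ] Colligation N E G} (hW : ∀ d, ‖W d‖ ^ 2 ≤ ‖d‖ ^ 2) (K : ℕ)
    (d : G) : ∑ σ ∈ wordsLT N K, ‖observe W σ d‖ ^ 2 ≤ ‖d‖ ^ 2 := by
  induction K generalizing d with
  | zero => simp [wordsLT]
  | succ K ih =>
    rw [sum_wordsLT]
    refine le_trans ?_ (hW d)
    rw [colligation_norm_sq, observe_nil]
    gcongr with i
    simpa only [observe_cons] using ih ((W d).snd i)

variable [CompleteSpace E] [CompleteSpace G]

/-- A contractive colligation `V = (V₁, V₂) : E ⊕ G ⊕ ⋯ ⊕ G → E ⊕ G` has a state map `Y` defined on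
`⊕ E_k`, and a transfer function in the Schur class. -/
lemma exists_realization (V₁ : Colligation N E G →L[ℂ] E) (V₂ : Colligation N E G →L[ℂ] G)
    (hV : ∀ h, ‖V₁ h‖ ^ 2 + ‖V₂ h‖ ^ 2 ≤ ‖h‖ ^ 2) :
    ∃ Y : Fock N E →L[ℂ] G, (∀ x, Y x = V₂ (colligationMap (coord []) (fun i => Y.comp (shift [i])) x))
      ∧ ∃ T ∈ schurClass N E,
        ∀ x, T x [] = V₁ (colligationMap (coord []) (fun i => Y.comp (shift [i])) x) := by
  let W := ContinuousLinearMap.adjoint V₂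
  have hV₂ : ‖V₂‖ ≤ 1 := ContinuousLinearMap.opNorm_le_bound _ zero_le_one fun h => by
    rw [one_mul]
    exact (sq_le_sq₀ (norm_nonneg _) (norm_nonneg _)).1
      (le_trans (le_add_of_nonneg_left (sq_nonneg _)) (hV h))
  have hW : ∀ d, ‖W d‖ ^ 2 ≤ ‖d‖ ^ 2 := fun d => by
    have h1 : ‖W‖ ≤ 1 := by simpa [W] using hV₂
    have h2 := W.le_of_opNorm_le h1 d
    rw [one_mul] at h2
    gcongr
  -- The state map is obtained as the adjoint of the observability operator of `V₂^*`: the relation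
  -- `S_i O = O W_i`, with `W_i` the `i`-th `G`-component of `W`, dualizes to the state recursion.
  let O : G →L[ℂ] Fock N E := ofColumn (observe W) (sum_observe_le hW)
  let Y := ContinuousLinearMap.adjoint O
  let S : Fock N E →L[ℂ] Colligation N E G := colligationMap (coord []) fun i => Y.comp (shift [i])
  have hO : ‖O‖ ≤ 1 := norm_ofColumn_le _ _
  have hY1 : ‖Y‖ ≤ 1 := by simpa [Y] using hO
  have hY2 : ∀ x, ‖Y x‖ ^ 2 ≤ ‖x‖ ^ 2 := fun x => by
    have h2 := Y.le_of_opNorm_le hY1 x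
    rw [one_mul] at h2
    gcongr
  have hYV : ∀ x, Y x = V₂ (S x) := fun x => by
    refine ext_inner_right ℂ fun d => ?_
    have h1 : ∀ i, shift [i] (O d) = O ((W d).snd i) := fun i => lp.ext rfl
    rw [ContinuousLinearMap.adjoint_inner_left, inner_eq_add_sum_shift,
      ← ContinuousLinearMap.adjoint_inner_right, colligation_inner]
    congr 1
    refine Finset.sum_congr rfl fun i _ => ?_
    rw [h1, ← ContinuousLinearMap.adjoint_inner_left]
    rfl
  -- The term `‖Y x‖²` is the energy held in the state; keeping it lets the induction on word length
  -- telescope.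
  have hT : ∀ (K : ℕ) (x : Fock N E),
      ∑ σ ∈ wordsLT N K, ‖V₁ (S (shift σ x))‖ ^ 2 + ‖Y x‖ ^ 2 ≤ ‖x‖ ^ 2 := by
    intro K
    induction K with
    | zero => simpa [wordsLT] using hY2
    | succ K ih =>
      intro x
      rw [sum_wordsLT, shift_nil]
      have h0 : ∀ i, ∑ σ ∈ wordsLT N K, ‖V₁ (S (shift (i :: σ) x))‖ ^ 2 + ‖Y (shift [i] x)‖ ^ 2 ≤
          ‖shift [i] x‖ ^ 2 := fun i => ih (shift [i] x)
      have h1 := Finset.sum_le_sum fun i (_ : i ∈ Finset.univ) => h0 i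
      rw [Finset.sum_add_distrib] at h1
      have h2 := hV (S x)
      rw [colligation_norm_sq, ← hYV] at h2
      have h3 := norm_sq_eq_add_sum_shift x
      simp only [S, colligationMap_fst, colligationMap_snd, coord_apply,
        ContinuousLinearMap.comp_apply] at h1 h2 ⊢
      linarith
  have hT' : ∀ (K : ℕ) (x : Fock N E),
      ∑ σ ∈ wordsLT N K, ‖(V₁.comp (S.comp (shift σ))) x‖ ^ 2 ≤ ‖x‖ ^ 2 := fun K x =>
    le_trans (le_add_of_nonneg_right (sq_nonneg _)) (hT K x)
  -- The component of `T x` at `σ` is the output for input `shift σ x`, so commutation with the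
  -- shifts is definitional.
  refine ⟨Y, hYV, ofColumn _ hT', ⟨(mem_toeplitzAlg_iff _).2 fun i x => lp.ext rfl,
    norm_ofColumn_le _ _⟩, fun x => rfl⟩

/-! ### Point evaluation on the columns -/

lemma shift_column (Z : opBall N E) (i : Fin N) (e : E) :
    shift [i] (column Z e) = column Z (Z.1 i e) :=
  lp.ext (funext fun σ => star_starWord_cons Z.1 i σ e)

lemma column_apply_nil (Z : opBall N E) (e : E) : column Z e [] = e := by
  change star (starWord Z.1 []) e = e
  simp [starWord]

lemma adjoint_L (Z : opBall N E) : ContinuousLinearMap.adjoint (L Z) = column Z :=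
  ContinuousLinearMap.adjoint_adjoint _

lemma pointEval_apply (T : Fock N E →L[ℂ] Fock N E) (Z : opBall N E) (e : E) :
    pointEval T Z e = T (column Z e) [] := by
  rw [pointEval, adjoint_L]
  rfl

/-- Commutation with the shifts carries the component at `[]`, which is the point evaluation, to
every word: moving one letter along replaces `e` by `Z_i e`. -/
lemma apply_column {T : Fock N E →L[ℂ] Fock N E} (hT : T ∈ toeplitzAlg N E) (Z : opBall N E)
    (e : E) : T (column Z e) = diag (pointEval T Z) (column Z e) := by
  rw [mem_toeplitzAlg_iff] at hT
  refine lp.ext (funext fun σ => ?_)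
  induction σ generalizing e with
  | nil => rw [diag_apply, column_apply_nil, pointEval_apply]
  | cons i σ ih =>
    calc T (column Z e) (i :: σ) = shift [i] (T (column Z e)) σ := rfl
      _ = diag (pointEval T Z) (shift [i] (column Z e)) σ := by rw [hT, shift_column, ih]
      _ = _ := rfl

lemma inner_diag_mul (A B : E →L[ℂ] E) (x y : Fock N E) :
    inner ℂ x (diag (1 - star A * B) y) = inner ℂ x y - inner ℂ (diag A x) (diag B y) := by
  refine (lp.hasSum_inner (𝕜 := ℂ) x (diag (1 - star A * B) y)).unique ?_
  have h : (fun σ => inner ℂ (x σ) (diag (1 - star A * B) y σ)) =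
      fun σ => inner ℂ (x σ) (y σ) - inner ℂ (diag A x σ) (diag B y σ) := funext fun σ => by
    simp [ContinuousLinearMap.star_eq_adjoint,
      ContinuousLinearMap.adjoint_inner_right]
  rw [h]
  exact (lp.hasSum_inner (𝕜 := ℂ) x y).sub (lp.hasSum_inner (𝕜 := ℂ) (diag A x) (diag B y))

omit [CompleteSpace G] in
/-- For `Z` in the open ball, `0` is the only bounded operator `f` with `f^* f ≤ ∑ Z_i^* f^* f Z_i`. -/
lemma eq_zero_of_norm_sq_le_sum {Z : Fin N → E →L[ℂ] E} (hZ : Z ∈ opBall N E) (f : E →L[ℂ] G)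
    (hf : ∀ e, ‖f e‖ ^ 2 ≤ ∑ i, ‖f (Z i e)‖ ^ 2) : f = 0 := by
  obtain ⟨r, hr, hb⟩ := exists_bound hZ
  have h1 : ∀ e, ‖f e‖ ^ 2 ≤ ‖f‖ ^ 2 * ((1 - r) * ‖e‖ ^ 2) := fun e => by
    refine (hf e).trans ((Finset.sum_le_sum (g := fun i => ‖f‖ ^ 2 * ‖Z i e‖ ^ 2)
      fun i _ => ?_).trans ?_)
    · rw [← mul_pow]
      gcongr
      exact f.le_opNorm _
    · rw [← Finset.mul_sum]
      have := hb e
      gcongr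
      linarith
  -- The maximum with `0` keeps the square root meaningful without knowing `r ≤ 1`; what matters is
  -- that the factor is less than `1`.
  have h2 : ‖f‖ ≤ √(‖f‖ ^ 2 * max (1 - r) 0) := by
    refine f.opNorm_le_bound (Real.sqrt_nonneg _) fun e => ?_
    refine (sq_le_sq₀ (norm_nonneg _) (by positivity)).1 ?_
    rw [mul_pow, Real.sq_sqrt (by positivity), mul_assoc]
    refine (h1 e).trans ?_
    gcongr
    exact le_max_left _ _
  rw [Real.le_sqrt (norm_nonneg _) (by positivity)] at h2
  have h3 : max (1 - r) 0 < 1 := max_lt (by linarith) one_pos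
  have h4 : ‖f‖ ^ 2 ≤ 0 := by nlinarith [sq_nonneg ‖f‖]
  exact norm_eq_zero.1 (pow_eq_zero_iff two_ne_zero |>.1 (le_antisymm h4 (sq_nonneg _)))

/-! ### The Pick matrix and necessity -/

/-- The operator `E^n → ⊕ E_k` with entries `diag[B_k] L(Z_k)^*`. -/
def columnSum {n : ℕ} (Z : Fin n → opBall N E) (B : Fin n → E →L[ℂ] E) :
    PiLp 2 (fun _ : Fin n => E) →L[ℂ] Fock N E :=
  ∑ k, (diag (B k)).comp ((column (Z k)).comp (PiLp.proj 2 (fun _ : Fin n => E) k))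

lemma columnSum_apply {n : ℕ} (Z : Fin n → opBall N E) (B : Fin n → E →L[ℂ] E)
    (x : PiLp 2 (fun _ : Fin n => E)) :
    columnSum Z B x = ∑ k, diag (B k) (column (Z k) (x k)) := by
  simp [columnSum]

omit [CompleteSpace E] in
lemma diag_one (x : Fock N E) : diag 1 x = x := rfl

lemma inner_pickMatrix {n : ℕ} (Z : Fin n → opBall N E) (B : Fin n → E →L[ℂ] E)
    (x y : PiLp 2 (fun _ : Fin n => E)) :
    inner ℂ x (pickMatrix Z B y) =
      inner ℂ (columnSum Z 1 x) (columnSum Z 1 y) - inner ℂ (columnSum Z B x) (columnSum Z B y) := by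
  simp only [columnSum_apply, Pi.one_apply, diag_one, sum_inner, inner_sum,
    ← Finset.sum_sub_distrib, PiLp.inner_apply, pickMatrix, blockOperator_apply]
  rw [Finset.sum_comm]
  refine Finset.sum_congr rfl fun k _ => Finset.sum_congr rfl fun j _ => ?_
  rw [ContinuousLinearMap.comp_apply, ContinuousLinearMap.comp_apply, adjoint_L,
    ← ContinuousLinearMap.adjoint_inner_left, adjoint_L, inner_diag_mul]

lemma pickMatrix_eq {n : ℕ} (Z : Fin n → opBall N E) (B : Fin n → E →L[ℂ] E) :
    pickMatrix Z B = (ContinuousLinearMap.adjoint (columnSum Z 1)).comp (columnSum Z 1) -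
      (ContinuousLinearMap.adjoint (columnSum Z B)).comp (columnSum Z B) := by
  ext1 x
  refine ext_inner_left ℂ fun y => ?_
  simp [inner_pickMatrix, inner_sub_right, ContinuousLinearMap.adjoint_inner_right]

lemma pickMatrix_isPositive_of_exists {n : ℕ} {Z : Fin n → opBall N E} {B : Fin n → E →L[ℂ] E}
    {T : Fock N E →L[ℂ] Fock N E} (hT : T ∈ schurClass N E) (hB : ∀ k, pointEval T (Z k) = B k) :
    (pickMatrix Z B).IsPositive := by
  have h : ∀ x, columnSum Z B x = T (columnSum Z 1 x) := fun x => by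
    simp [columnSum_apply, diag_one, apply_column hT.1, hB]
  rw [ContinuousLinearMap.isPositive_def']
  refine ⟨?_, fun x => ?_⟩
  · rw [pickMatrix_eq]
    exact (ContinuousLinearMap.isPositive_adjoint_comp_self _).isSelfAdjoint.sub
      (ContinuousLinearMap.isPositive_adjoint_comp_self _).isSelfAdjoint
  · rw [ContinuousLinearMap.reApplyInnerSelf_apply, inner_re_symm, inner_pickMatrix, map_sub,
      inner_self_eq_norm_sq, inner_self_eq_norm_sq, h, sub_nonneg]
    have := T.le_of_opNorm_le hT.2 (columnSum Z 1 x)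
    rw [one_mul] at this
    gcongr

/-! ### Sufficiency: the lurking isometry -/

lemma exists_norm_sq_eq_inner {P : G →L[ℂ] G} (hP : P.IsPositive) :
    ∃ D : G →L[ℂ] G, ∀ x, ‖D x‖ ^ 2 = RCLike.re (inner ℂ x (P x)) := by
  rw [← ContinuousLinearMap.nonneg_iff_isPositive] at hP
  refine ⟨CFC.sqrt P, fun x => ?_⟩
  have h1 : ContinuousLinearMap.adjoint (CFC.sqrt P) = CFC.sqrt P :=
    (CFC.sqrt_nonneg P).isSelfAdjoint
  rw [← inner_self_eq_norm_sq (𝕜 := ℂ), ← ContinuousLinearMap.adjoint_inner_right, h1]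
  conv_rhs => rw [← CFC.sqrt_mul_sqrt_self P hP]
  rfl

/-- The operator `(x_k) ↦ (Z_{k,i} x_k)` on `E^n`. -/
def diagTuple {n : ℕ} (Z : Fin n → opBall N E) (i : Fin N) :
    PiLp 2 (fun _ : Fin n => E) →L[ℂ] PiLp 2 (fun _ : Fin n => E) :=
  (PiLp.continuousLinearEquiv 2 ℂ (fun _ : Fin n => E)).symm.toContinuousLinearMap.comp
    (ContinuousLinearMap.pi fun k => ((Z k).1 i).comp (PiLp.proj 2 (fun _ : Fin n => E) k))

@[simp] lemma diagTuple_apply {n : ℕ} (Z : Fin n → opBall N E) (i : Fin N)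
    (x : PiLp 2 (fun _ : Fin n => E)) (k : Fin n) : diagTuple Z i x k = (Z k).1 i (x k) := rfl

omit [CompleteSpace E] in
lemma shift_diag (i : Fin N) (X : E →L[ℂ] E) (x : Fock N E) :
    shift [i] (diag X x) = diag X (shift [i] x) := rfl

lemma columnSum_apply_nil {n : ℕ} (Z : Fin n → opBall N E) (B : Fin n → E →L[ℂ] E)
    (x : PiLp 2 (fun _ : Fin n => E)) : columnSum Z B x [] = ∑ k, B k (x k) := by
  rw [← coord_apply, columnSum_apply, map_sum]
  simp [column_apply_nil]

lemma shift_columnSum {n : ℕ} (Z : Fin n → opBall N E) (B : Fin n → E →L[ℂ] E) (i : Fin N)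
    (x : PiLp 2 (fun _ : Fin n => E)) :
    shift [i] (columnSum Z B x) = columnSum Z B (diagTuple Z i x) := by
  simp [columnSum_apply, shift_diag, shift_column]

/-- The Stein identity for the Pick matrix, as an identity of quadratic forms. -/
lemma re_inner_pickMatrix {n : ℕ} (Z : Fin n → opBall N E) (B : Fin n → E →L[ℂ] E)
    (x : PiLp 2 (fun _ : Fin n => E)) :
    RCLike.re (inner ℂ x (pickMatrix Z B x)) + ‖∑ k, B k (x k)‖ ^ 2 = ‖∑ k, x k‖ ^ 2 +
      ∑ i, RCLike.re (inner ℂ (diagTuple Z i x) (pickMatrix Z B (diagTuple Z i x))) := by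
  have h : ∀ x, RCLike.re (inner ℂ x (pickMatrix Z B x)) =
      ‖columnSum Z 1 x‖ ^ 2 - ‖columnSum Z B x‖ ^ 2 := fun x => by
    rw [inner_pickMatrix, map_sub, inner_self_eq_norm_sq, inner_self_eq_norm_sq]
  have h1 := norm_sq_eq_add_sum_shift (columnSum Z 1 x)
  have h2 := norm_sq_eq_add_sum_shift (columnSum Z B x)
  simp only [shift_columnSum, columnSum_apply_nil] at h1 h2
  simp only [h, Finset.sum_sub_distrib]
  simp only [Pi.one_apply, one_apply_eq_self] at h1
  linarith

lemma exists_of_pickMatrix_isPositive {n : ℕ} {Z : Fin n → opBall N E} {B : Fin n → E →L[ℂ] E}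
    (hP : (pickMatrix Z B).IsPositive) :
    ∃ T ∈ schurClass N E, ∀ k, pointEval T (Z k) = B k := by
  obtain ⟨D, hD⟩ := exists_norm_sq_eq_inner hP
  let X := PiLp 2 (fun _ : Fin n => E)
  -- The squared norms of `a x` and `b x` are the two sides of the Stein identity, so they are
  -- equal.
  let a : X →L[ℂ] Colligation N E X :=
    colligationMap (∑ k, PiLp.proj 2 (fun _ : Fin n => E) k) fun i => D.comp (diagTuple Z i)
  let b₁ : X →L[ℂ] E := ∑ k, (B k).comp (PiLp.proj 2 (fun _ : Fin n => E) k)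
  let b : X →L[ℂ] WithLp 2 (E × X) :=
    (WithLp.prodContinuousLinearEquiv 2 ℂ E X).symm.toContinuousLinearMap.comp (b₁.prod D)
  have ha : ∀ x, (a x).fst = ∑ k, x k := fun x => by
    simp only [a, colligationMap_fst, sum_apply]
    rfl
  have hb₁ : ∀ x, b₁ x = ∑ k, B k (x k) := fun x => by
    simp only [b₁, sum_apply]
    rfl
  have hab : ∀ x, ‖b x‖ ≤ ‖a x‖ := fun x => by
    refine (sq_le_sq₀ (norm_nonneg _) (norm_nonneg _)).1 (le_of_eq ?_)
    have h := re_inner_pickMatrix Z B x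
    simp only [← hD, ← hb₁] at h
    rw [colligation_norm_sq (a x), WithLp.prod_norm_sq_eq_of_L2 (b x), ha, add_comm]
    exact h
  obtain ⟨V, hV, hVab⟩ := exists_contraction_of_norm_le a.toLinearMap b.toLinearMap hab
  obtain ⟨Y, hY, T, hT, hTV⟩ := exists_realization ((WithLp.fstL 2 ℂ E X).comp V)
    ((WithLp.sndL 2 ℂ E X).comp V) fun h => by
      have h1 := V.le_of_opNorm_le hV h
      rw [one_mul] at h1
      refine le_trans (le_of_eq (WithLp.prod_norm_sq_eq_of_L2 (V h)).symm) ?_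
      gcongr
  have hV1 : ∀ x, (V (a x)).fst = ∑ k, B k (x k) := fun x => by
    rw [← hb₁]
    exact congrArg WithLp.fst (hVab x)
  have hV2 : ∀ x, (V (a x)).snd = D x := fun x => congrArg WithLp.snd (hVab x)
  refine ⟨T, hT, fun k => ?_⟩
  let s : E →L[ℂ] X := (PiLp.continuousLinearEquiv 2 ℂ (fun _ : Fin n => E)).symm.toContinuousLinearMap.comp
    (ContinuousLinearMap.single ℂ (fun _ : Fin n => E) k)
  have hs : ∀ e j, s e j = if j = k then e else 0 := fun e j => by
    change (Pi.single k e : Fin n → E) j = _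
    rw [Pi.single_apply]
  have hsZ : ∀ i e, diagTuple Z i (s e) = s ((Z k).1 i e) := fun i e => by
    refine PiLp.ext fun j => ?_
    rw [diagTuple_apply, hs, hs]
    split_ifs with h
    · rw [h]
    · simp
  -- Both `Y C_{Z_k}` and `D s` solve the state recursion with the same input `e`. Their difference
  -- `f` thus satisfies `‖f e‖² ≤ ∑ ‖f (Z_i e)‖²`, since `V` is contractive and the `E`-components
  -- cancel.
  have hYs : Y.comp (column (Z k)) - D.comp s = 0 := by
    refine eq_zero_of_norm_sq_le_sum (Z k).2 _ fun e => ?_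
    let S := colligationMap (coord []) (fun i => Y.comp (shift [i])) (column (Z k) e)
    have h1 : Y (column (Z k) e) - D (s e) = (V (S - a (s e))).snd := by
      rw [hY, ← hV2, map_sub]
      rfl
    have h2 := V.le_of_opNorm_le hV (S - a (s e))
    have h3 : ‖(V (S - a (s e))).snd‖ ^ 2 ≤ ‖V (S - a (s e))‖ ^ 2 := by
      rw [WithLp.prod_norm_sq_eq_of_L2]
      exact le_add_of_nonneg_left (sq_nonneg _)
    have h4 : (S - a (s e)).fst = 0 := by
      rw [WithLp.sub_fst, ha]
      simp [S, column_apply_nil, hs]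
    have h5 : ∀ i, (S - a (s e)).snd i =
        (Y.comp (column (Z k)) - D.comp s) ((Z k).1 i e) := fun i => by
      rw [WithLp.sub_snd, PiLp.sub_apply]
      simp [S, a, shift_column, hsZ]
    rw [one_mul] at h2
    calc ‖Y (column (Z k) e) - D (s e)‖ ^ 2 ≤ ‖V (S - a (s e))‖ ^ 2 := by rw [h1]; exact h3
      _ ≤ ‖S - a (s e)‖ ^ 2 := by gcongr
      _ = _ := by
        rw [colligation_norm_sq, h4]
        simp only [h5, norm_zero]
        simp
  have hYs' : ∀ e, Y (column (Z k) e) = D (s e) := fun e =>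
    sub_eq_zero.1 (DFunLike.congr_fun hYs e)
  ext e
  -- With the states identified, the system on `C_{Z_k} e` sits at a point of the range of `a`,
  -- where `V` is known explicitly.
  have hS : colligationMap (coord []) (fun i => Y.comp (shift [i])) (column (Z k) e) = a (s e) := by
    refine colligation_ext ?_ fun i => ?_
    · rw [ha]
      simp [column_apply_nil, hs]
    · simp [a, shift_column, hsZ, hYs']
  rw [pointEval_apply, hTV, hS]
  change (V (a (s e))).fst = _
  rw [hV1, Finset.sum_eq_single k]
  · simp [hs]
  · intro j _ hj
    simp [hs, hj]
  · simp

end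

end NCInterp

theorem mainTheorem2 {E : Type*} [NormedAddCommGroup E] [InnerProductSpace ℂ E] [CompleteSpace E]
    (N : ℕ) (hN : 0 < N) (n : ℕ)
    (Z : Fin n → NCInterp.opBall N E) (hZ : Function.Injective Z) (B : Fin n → E →L[ℂ] E) :
    (∃ T ∈ NCInterp.schurClass N E, ∀ k, NCInterp.pointEval T (Z k) = B k) ↔
      (NCInterp.pickMatrix Z B).IsPositive :=
  ⟨fun ⟨_, hT, hB⟩ => NCInterp.pickMatrix_isPositive_of_exists hT hB,
    NCInterp.exists_of_pickMatrix_isPositive⟩
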